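/- An \emph{mm-space} is a Polish metric space $X$ of diameter at most one with a Borel probability measure $\mu_X$ of full support. For functions $f,g:[0,1]^2\to\mathbb{R}$ let $\square_1(f,g)$ be the infimum of the $\varepsilon\ge 0$ for which there is a measurable set $S\subseteq[0,1]$ of Lebesgue measure at most $\varepsilon$ with $|f(s,t)-g(s,t)|\le\varepsilon$ for all $s,t\in[0,1]\setminus S$. For mm-spaces $X,Y$ let $$\underline{\square}_1(X,Y)=\inf_{\Psi_1,\Psi_2}\square_1\bigl(d_X\circ(\Psi_1\times\Psi_1),\,d_Y\circ(\Psi_2\times\Psi_2)\bigr),$$ the infimum over all measure preserving maps $\Psi_1:([0,1],\lambda)\to(X,\mu_X)$ and $\Psi_2:([0,1],\lambda)\to(Y,\mu_Y)$. Let $\omega$ be a nonprincipal ultrafilter on $\mathbb{N}$ and $(X_n)$ a sequence of mm-spaces. Let $\mathbf{X}$ be the set of sequences in $\prod_n X_n$, two sequences being identified if they agree for $\omega$-almost every $n$, with the pseudo-metric $d([x],[y])=\lim_\omega d_{X_n}(x_n,y_n)$; the \emph{metric ultralimit} $\underline{\mathbf{X}}$ is its quotient by the relation $d=0$, with projection $\pi:\mathbf{X}\to\underline{\mathbf{X}}$.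 For Borel sets $A_n\subseteq X_n$ put $[A_n]=\{[x]: x_n\in A_n\text{ for }\omega\text{-almost every }n\}$, of mass $\lim_\omega\mu_{X_n}(A_n)$. A set $N\subseteq\mathbf{X}$ is null if for every $\varepsilon>0$ it is contained in some $[A_n]$ of mass less than $\varepsilon$. A set $M\subseteq\mathbf{X}$ is measurable if $M\triangle[A_n]$ is null for some Borel $A_n$, and then $\mu_{\mathbf{X}}(M)=\lim_\omega\mu_{X_n}(A_n)$. A set $A\subseteq\underline{\mathbf{X}}$ is admissible if $\pi^{-1}(A)$ is measurable, and then $\mu_{\underline{\mathbf{X}}}(A)=\mu_{\mathbf{X}}(\pi^{-1}(A))$. The support of $\underline{\mathbf{X}}$ is the set of points $p$ such that every closed ball of positive radius around $p$ (such balls are admissible) has positive measure. The support is said to be isometric to an mm-space $X$ (as a metric measure space) if there is a surjective isometry $\Phi$ from $X$ onto the support such that, for every Borel set $B\subseteq X$, the set $\Phi(B)$ is admissible and $\mu_{\underline{\mathbf{X}}}(\Phi(B))=\mu_X(B)$. \textbf{Proposition.} Let $X$ be an mm-space. (1) If $\underline{\square}_1(X_n,X)\to 0$ as $n\to\infty$,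 then the support of the metric ultralimit $\underline{\mathbf{X}}$ is isometric to $X$. (2) Conversely, if the support of $\underline{\mathbf{X}}$ is isometric to $X$, then $X=\lim_\omega X_n$ in the $\underline{\square}_1$-metric, that is, for every $\varepsilon>0$, $$\{n : \underline{\square}_1(X_n,X)<\varepsilon\}\in\omega.$$ -/

import Mathlib

open MeasureTheory Filter Topology
open scoped ENNReal NNReal unitInterval

universe u v

/-- An mm-space: a Polish metric space of diameter at most one with a Borel probability measure of
full support. -/
structure MMSpace where
  carrier : Type u
  [metric : MetricSpace carrier]
  [complete : CompleteSpace carrier]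
  [separable : TopologicalSpace.SeparableSpace carrier]
  [meas : MeasurableSpace carrier]
  [borel : BorelSpace carrier]
  μ : Measure carrier
  [prob : IsProbabilityMeasure μ]
  [fullSupport : μ.IsOpenPosMeasure]
  dist_le_one : ∀ x y : carrier, dist x y ≤ 1

namespace MMSpace

instance : CoeSort MMSpace.{u} (Type u) := ⟨MMSpace.carrier⟩

attribute [instance] metric complete separable meas borel prob fullSupport

instance (X : MMSpace.{u}) : Nonempty X := nonempty_of_isProbabilityMeasure X.μ

/-! ### The box distance -/

/-- `f` and `g` are `ε`-close on `Sᶜ × Sᶜ` for some set `S ⊆ [0,1]` of Lebesgue measure at most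
`ε`. -/
def BoxClose (ε : ℝ≥0) (f g : I → I → ℝ) : Prop :=
  ∃ S : Set I, MeasurableSet S ∧ volume S ≤ ε ∧
    ∀ s ∉ S, ∀ t ∉ S, |f s t - g s t| ≤ ε

/-- The `□₁`-distance of two functions on `[0,1]²`: the infimal `ε` for which they are `ε`-close
outside a set of measure at most `ε`. -/
noncomputable def boxFun (f g : I → I → ℝ) : ℝ≥0∞ :=
  ⨅ (ε : ℝ≥0) (_ : BoxClose ε f g), (ε : ℝ≥0∞)

/-- The pull-back of the distance function of `X` under `Ψ : [0,1] → X`. -/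
def pullDist (X : MMSpace.{u}) (Ψ : I → X) : I → I → ℝ := fun s t => dist (Ψ s) (Ψ t)

/-- The `□₁`-distance of two mm-spaces: the infimum of the `□₁`-distances of the pulled back
distance functions over all pairs of measure preserving maps from `([0,1], λ)`. -/
noncomputable def boxDist (X : MMSpace.{u}) (Y : MMSpace.{v}) : ℝ≥0∞ :=
  ⨅ (Ψ₁ : I → X) (_ : MeasurePreserving Ψ₁ volume X.μ)
    (Ψ₂ : I → Y) (_ : MeasurePreserving Ψ₂ volume Y.μ),
    boxFun (X.pullDist Ψ₁) (Y.pullDist Ψ₂)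

/-! ### The set-theoretical ultralimit and its pseudo-metric -/

variable (ω : Ultrafilter ℕ) (X : ℕ → MMSpace.{u})

/-- The set-theoretical ultralimit: sequences `x ∈ ∏ X n`, identified when they agree for
`ω`-almost every `n`. -/
def SetUltralimit : Type u := (ω : Filter ℕ).Product (fun n => (X n : Type u))

variable {X}

/-- The class of a sequence of points. -/
def cls (x : ∀ n, X n) : SetUltralimit ω X :=
  @Quotient.mk' _ (productSetoid (ω : Filter ℕ) (fun n => (X n : Type u))) x

variable {ω}

theorem cls_surjective (p : SetUltralimit ω X) : ∃ x, cls ω x = p := Quotient.exists_rep p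

theorem cls_eq_cls {x y : ∀ n, X n} : cls ω x = cls ω y ↔ ∀ᶠ n in (ω : Filter ℕ), x n = y n :=
  @Quotient.eq _ (productSetoid (ω : Filter ℕ) (fun n => (X n : Type u))) x y

theorem tendsto_dist (x y : ∀ n, X n) :
    Tendsto (fun n => dist (x n) (y n)) (ω : Filter ℕ)
      (𝓝 (limUnder (ω : Filter ℕ) fun n => dist (x n) (y n))) := by
  apply tendsto_nhds_limUnder
  obtain ⟨d, -, hd⟩ := (isCompact_Icc (a := (0 : ℝ)) (b := 1)).ultrafilter_le_nhds
    (ω.map fun n => dist (x n) (y n)) (by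
      rw [le_principal_iff, Ultrafilter.mem_coe, Ultrafilter.mem_map]
      exact Filter.univ_mem' fun n => ⟨dist_nonneg, (X n).dist_le_one _ _⟩)
  exact ⟨d, hd⟩

/-- `d([x], [y]) = lim_ω d(x n, y n)`. -/
noncomputable instance : Dist (SetUltralimit ω X) where
  dist := Quotient.lift₂ (s₁ := productSetoid (ω : Filter ℕ) (fun n => (X n : Type u)))
    (s₂ := productSetoid (ω : Filter ℕ) (fun n => (X n : Type u)))
    (fun x y => limUnder (ω : Filter ℕ) fun n => dist (x n) (y n)) (by
      intro a b a' b' h h'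
      refine (Tendsto.limUnder_eq ?_)
      refine (tendsto_dist a' b').congr' ?_
      filter_upwards [h, h'] with n hn hn'
      rw [hn, hn'])

theorem dist_cls (x y : ∀ n, X n) :
    dist (cls ω x) (cls ω y) = limUnder (ω : Filter ℕ) fun n => dist (x n) (y n) := rfl

theorem tendsto_dist_cls (x y : ∀ n, X n) :
    Tendsto (fun n => dist (x n) (y n)) (ω : Filter ℕ) (𝓝 (dist (cls ω x) (cls ω y))) :=
  tendsto_dist x y

noncomputable instance : PseudoMetricSpace (SetUltralimit ω X) where
  dist_self p := by
    obtain ⟨x, rfl⟩ := cls_surjective p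
    refine tendsto_nhds_unique (tendsto_dist_cls x x) ?_
    simp
  dist_comm p q := by
    obtain ⟨x, rfl⟩ := cls_surjective p
    obtain ⟨y, rfl⟩ := cls_surjective q
    rw [dist_cls, dist_cls]
    simp only [dist_comm]
  dist_triangle p q r := by
    obtain ⟨x, rfl⟩ := cls_surjective p
    obtain ⟨y, rfl⟩ := cls_surjective q
    obtain ⟨z, rfl⟩ := cls_surjective r
    exact le_of_tendsto_of_tendsto' (tendsto_dist_cls x z)
      ((tendsto_dist_cls x y).add (tendsto_dist_cls y z)) fun n => dist_triangle _ _ _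

/-! ### The ultralimit measure on the set-theoretical ultralimit -/

/-- The ultralimit of a sequence of subsets. -/
def limSet (ω : Ultrafilter ℕ) (A : ∀ n, Set (X n)) : Set (SetUltralimit ω X) :=
  {p | ∃ x, cls ω x = p ∧ ∀ᶠ n in (ω : Filter ℕ), x n ∈ A n}

/-- The finitely additive measure of an ultralimit set: the ultralimit of the measures. -/
noncomputable def limMass (ω : Ultrafilter ℕ) (A : ∀ n, Set (X n)) : ℝ≥0∞ :=
  limUnder (ω : Filter ℕ) fun n => (X n).μ (A n)

/-- Nullsets: for every `ε > 0`, contained in an ultralimit of measurable sets of mass less than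
`ε`. -/
def IsNull (N : Set (SetUltralimit ω X)) : Prop :=
  ∀ ε : ℝ≥0∞, 0 < ε → ∃ A : ∀ n, Set (X n), (∀ n, MeasurableSet (A n)) ∧
    N ⊆ limSet ω A ∧ limMass ω A < ε

/-- `M` differs from the ultralimit of the measurable sets `A n` by a nullset. -/
def Approx (M : Set (SetUltralimit ω X)) (A : ∀ n, Set (X n)) : Prop :=
  (∀ n, MeasurableSet (A n)) ∧ IsNull (symmDiff (limSet ω A) M)

theorem cls_mem_limSet {x : ∀ n, X n} {A : ∀ n, Set (X n)} :
    cls ω x ∈ limSet ω A ↔ ∀ᶠ n in (ω : Filter ℕ), x n ∈ A n := by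
  constructor
  · rintro ⟨y, hy, h⟩
    filter_upwards [cls_eq_cls.1 hy, h] with n h1 h2
    rwa [← h1]
  · exact fun h => ⟨x, rfl, h⟩

theorem tendsto_limMass (A : ∀ n, Set (X n)) :
    Tendsto (fun n => (X n).μ (A n)) (ω : Filter ℕ) (𝓝 (limMass ω A)) := by
  apply tendsto_nhds_limUnder
  obtain ⟨d, -, hd⟩ := (isCompact_univ (X := ℝ≥0∞)).ultrafilter_le_nhds
    (ω.map fun n => (X n).μ (A n)) (by simp)
  exact ⟨d, hd⟩

theorem limMass_le_one (A : ∀ n, Set (X n)) : limMass ω A ≤ 1 :=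
  le_of_tendsto' (tendsto_limMass A) fun _ => prob_le_one

theorem limSet_compl (A : ∀ n, Set (X n)) : limSet ω (fun n => (A n)ᶜ) = (limSet ω A)ᶜ := by
  ext p
  obtain ⟨x, rfl⟩ := cls_surjective p
  rw [Set.mem_compl_iff, cls_mem_limSet, cls_mem_limSet, ← Ultrafilter.eventually_not]
  rfl

theorem limSet_union (A B : ∀ n, Set (X n)) :
    limSet ω (fun n => A n ∪ B n) = limSet ω A ∪ limSet ω B := by
  ext p
  obtain ⟨x, rfl⟩ := cls_surjective p
  rw [Set.mem_union, cls_mem_limSet, cls_mem_limSet, cls_mem_limSet, ← Ultrafilter.eventually_or]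
  rfl

theorem limSet_inter (A B : ∀ n, Set (X n)) :
    limSet ω (fun n => A n ∩ B n) = limSet ω A ∩ limSet ω B := by
  ext p
  obtain ⟨x, rfl⟩ := cls_surjective p
  rw [Set.mem_inter_iff, cls_mem_limSet, cls_mem_limSet, cls_mem_limSet, ← eventually_and]
  rfl

theorem limSet_diff (A B : ∀ n, Set (X n)) :
    limSet ω (fun n => A n \ B n) = limSet ω A \ limSet ω B := by
  simp only [Set.sdiff_eq, limSet_inter, limSet_compl]

theorem limSet_empty : limSet ω (fun n => (∅ : Set (X n))) = ∅ := by
  ext p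
  obtain ⟨x, rfl⟩ := cls_surjective p
  simp [cls_mem_limSet, ω.neBot.ne]

theorem limMass_empty : limMass ω (fun n => (∅ : Set (X n))) = 0 :=
  tendsto_nhds_unique (tendsto_limMass _) (by simp)

theorem eventually_subset {A B : ∀ n, Set (X n)} (h : limSet ω A ⊆ limSet ω B) :
    ∀ᶠ n in (ω : Filter ℕ), A n ⊆ B n := by
  classical
  by_contra hc
  rw [← Ultrafilter.eventually_not] at hc
  have : ∀ n, ∃ x : X n, ¬ A n ⊆ B n → x ∈ A n ∧ x ∉ B n := by
    intro n
    by_cases hn : A n ⊆ B n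
    · exact ⟨Classical.arbitrary _, fun h => (h hn).elim⟩
    · obtain ⟨x, h1, h2⟩ := Set.not_subset.1 hn
      exact ⟨x, fun _ => ⟨h1, h2⟩⟩
  choose x hx using this
  have h1 : cls ω x ∈ limSet ω B := h (cls_mem_limSet.2 (hc.mono fun n hn => (hx n hn).1))
  obtain ⟨n, hn, hn'⟩ := ((cls_mem_limSet.1 h1).and hc).exists
  exact (hx n hn').2 hn

theorem limMass_mono {A B : ∀ n, Set (X n)} (h : limSet ω A ⊆ limSet ω B) :
    limMass ω A ≤ limMass ω B :=
  le_of_tendsto_of_tendsto (tendsto_limMass A) (tendsto_limMass B)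
    ((eventually_subset h).mono fun _ hn => measure_mono hn)

theorem limMass_union_le (A B : ∀ n, Set (X n)) :
    limMass ω (fun n => A n ∪ B n) ≤ limMass ω A + limMass ω B :=
  le_of_tendsto_of_tendsto' (tendsto_limMass _) ((tendsto_limMass A).add (tendsto_limMass B))
    fun _ => measure_union_le _ _

theorem limMass_union_add_inter (A : ∀ n, Set (X n)) {B : ∀ n, Set (X n)}
    (hB : ∀ n, MeasurableSet (B n)) :
    limMass ω (fun n => A n ∪ B n) + limMass ω (fun n => A n ∩ B n) =
      limMass ω A + limMass ω B := by
  refine tendsto_nhds_unique ((tendsto_limMass _).add (tendsto_limMass _)) ?_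
  simp only [measure_union_add_inter _ (hB _)]
  exact (tendsto_limMass A).add (tendsto_limMass B)

/-- Saturation: countably many ultralimit sets are covered by one of no larger mass than
the supremum of the masses of the finite unions. -/
theorem exists_cover (A : ℕ → ∀ n, Set (X n)) (hA : ∀ k n, MeasurableSet (A k n)) (c : ℝ≥0∞)
    (hc : c ≠ ∞) (h : ∀ k, limMass ω (fun n => Set.accumulate (fun j => A j n) k) ≤ c) :
    ∃ B : ∀ n, Set (X n), (∀ n, MeasurableSet (B n)) ∧ (∀ k, limSet ω (A k) ⊆ limSet ω B) ∧
      limMass ω B ≤ c := by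
  classical
  let acc : ℕ → ∀ n, Set (X n) := fun k n => Set.accumulate (fun j => A j n) k
  have hacc : ∀ k n, MeasurableSet (acc k n) := fun k n =>
    MeasurableSet.biUnion (Set.to_countable _) fun j _ => hA j n
  let E : ℕ → ∀ n, Set (X n) := fun k n =>
    if (X n).μ (acc k n) ≤ c + (k + 1 : ℝ≥0∞)⁻¹ then acc k n else ∅
  have hEmeas : ∀ k n, MeasurableSet (E k n) := by
    intro k n
    dsimp only [E]
    split_ifs
    exacts [hacc k n, MeasurableSet.empty]
  have hmono : ∀ n, Monotone fun k => acc k n := fun n => Set.monotone_accumulate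
  have hdir : ∀ n, Directed (· ⊆ ·) fun k => E k n := by
    intro n i j
    by_cases hi : (X n).μ (acc i n) ≤ c + (i + 1 : ℝ≥0∞)⁻¹
    · by_cases hj : (X n).μ (acc j n) ≤ c + (j + 1 : ℝ≥0∞)⁻¹
      · rcases le_total i j with hij | hij
        · exact ⟨j, by simpa [E, hi, hj] using hmono n hij, subset_rfl⟩
        · exact ⟨i, subset_rfl, by simpa [E, hi, hj] using hmono n hij⟩
      · exact ⟨i, subset_rfl, by simp [E, hj]⟩
    · exact ⟨j, by simp [E, hi], subset_rfl⟩
  have hgood : ∀ k : ℕ, ∀ᶠ n in (ω : Filter ℕ), (X n).μ (acc k n) ≤ c + (k + 1 : ℝ≥0∞)⁻¹ := by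
    intro k
    have hlt : limMass ω (acc k) < c + (k + 1 : ℝ≥0∞)⁻¹ :=
      (h k).trans_lt (ENNReal.lt_add_right hc (by simp))
    exact ((tendsto_limMass (acc k)).eventually (gt_mem_nhds hlt)).mono fun _ hn => hn.le
  refine ⟨fun n => ⋃ k, E k n, fun n => MeasurableSet.iUnion fun k => hEmeas k n, ?_, ?_⟩
  · intro k p hp
    obtain ⟨x, rfl⟩ := cls_surjective p
    rw [cls_mem_limSet] at hp ⊢
    filter_upwards [hp, hgood k] with n h1 h2
    refine Set.mem_iUnion.2 ⟨k, ?_⟩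
    simp only [E, h2, if_true]
    exact Set.subset_accumulate h1
  · have key : ∀ K : ℕ, limMass ω (fun n => ⋃ k, E k n) ≤ c + (K + 1 : ℝ≥0∞)⁻¹ := by
      intro K
      refine le_of_tendsto (tendsto_limMass _) ((hgood K).mono fun n hn => ?_)
      rw [(hdir n).measure_iUnion]
      refine iSup_le fun k => ?_
      by_cases hk : (X n).μ (acc k n) ≤ c + (k + 1 : ℝ≥0∞)⁻¹
      · simp only [E, hk, if_true]
        rcases le_total k K with hkK | hkK
        · exact (measure_mono (hmono n hkK)).trans hn
        · refine hk.trans ?_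
          gcongr
      · simp [E, hk]
    refine ge_of_tendsto' (x := atTop) (f := fun K : ℕ => c + (K + 1 : ℝ≥0∞)⁻¹) ?_ key
    have h0 : Tendsto (fun K : ℕ => ((K + 1 : ℕ) : ℝ≥0∞)⁻¹) atTop (𝓝 0) :=
      ENNReal.tendsto_inv_nat_nhds_zero.comp (tendsto_add_atTop_nat 1)
    simpa using (tendsto_const_nhds (x := c)).add h0

theorem IsNull.mono {M N : Set (SetUltralimit ω X)} (h : IsNull N) (hMN : M ⊆ N) : IsNull M :=
  fun ε hε => let ⟨A, h1, h2, h3⟩ := h ε hε; ⟨A, h1, hMN.trans h2, h3⟩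

theorem limMass_accumulate_le (A : ℕ → ∀ n, Set (X n)) (k : ℕ) :
    limMass ω (fun n => Set.accumulate (fun j => A j n) k) ≤
      ∑ j ∈ Finset.range (k + 1), limMass ω (A j) := by
  refine le_of_tendsto_of_tendsto' (tendsto_limMass _)
    (tendsto_finsetSum _ fun j _ => tendsto_limMass (A j)) fun n => ?_
  have : Set.accumulate (fun j => A j n) k = ⋃ j ∈ Finset.range (k + 1), A j n := by
    ext x
    simp [Set.mem_accumulate]
  rw [this]
  exact measure_biUnion_finset_le _ _

theorem IsNull.iUnion {N : ℕ → Set (SetUltralimit ω X)} (h : ∀ k, IsNull (N k)) :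
    IsNull (⋃ k, N k) := by
  intro ε hε
  obtain ⟨c, hc0, hcε⟩ := exists_between hε
  obtain ⟨δ, hδ, hδc⟩ := ENNReal.exists_pos_sum_of_countable' hc0.ne' ℕ
  choose A hA hN hm using fun k => h k (δ k) (hδ k)
  obtain ⟨B, hB, hcov, hBc⟩ := exists_cover A hA c hcε.ne_top fun k =>
    (limMass_accumulate_le A k).trans
      (((Finset.sum_le_sum fun j _ => (hm j).le).trans (ENNReal.sum_le_tsum _)).trans hδc.le)
  exact ⟨B, hB, Set.iUnion_subset fun k => (hN k).trans (hcov k), hBc.trans_lt hcε⟩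

theorem isNull_empty : IsNull (∅ : Set (SetUltralimit ω X)) := fun _ hε =>
  ⟨fun _ => ∅, fun _ => MeasurableSet.empty, Set.empty_subset _, by rwa [limMass_empty]⟩

theorem IsNull.union {M N : Set (SetUltralimit ω X)} (hM : IsNull M) (hN : IsNull N) :
    IsNull (M ∪ N) := by
  have : IsNull (⋃ k : ℕ, if k = 0 then M else N) :=
    IsNull.iUnion fun k => by split_ifs <;> assumption
  refine this.mono (Set.union_subset ?_ ?_)
  · exact Set.subset_iUnion_of_subset 0 (by simp)
  · exact Set.subset_iUnion_of_subset 1 (by simp)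

theorem limMass_eq_zero {A : ∀ n, Set (X n)} (h : IsNull (limSet ω A)) : limMass ω A = 0 := by
  refine le_antisymm (le_of_forall_gt fun ε hε => ?_) zero_le
  obtain ⟨B, -, hB, hBε⟩ := h ε hε
  exact (limMass_mono hB).trans_lt hBε

theorem limMass_le_of_isNull_diff {A B : ∀ n, Set (X n)} (h : IsNull (limSet ω A \ limSet ω B)) :
    limMass ω A ≤ limMass ω B := by
  rw [← limSet_diff] at h
  calc limMass ω A ≤ limMass ω (fun n => B n ∪ (A n \ B n)) := limMass_mono (by
        rw [limSet_union, limSet_diff]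
        intro p hp
        by_cases hB : p ∈ limSet ω B
        · exact Or.inl hB
        · exact Or.inr ⟨hp, hB⟩)
    _ ≤ limMass ω B + limMass ω (fun n => A n \ B n) := limMass_union_le _ _
    _ = limMass ω B := by rw [limMass_eq_zero h, add_zero]

/-- The measure of a measurable set does not depend on the approximating ultralimit set. -/
theorem Approx.limMass_eq {M : Set (SetUltralimit ω X)} {A B : ∀ n, Set (X n)}
    (hA : Approx M A) (hB : Approx M B) : limMass ω A = limMass ω B := by
  have h := hA.2.union hB.2
  refine le_antisymm (limMass_le_of_isNull_diff (h.mono ?_))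
    (limMass_le_of_isNull_diff (h.mono ?_)) <;>
  · intro p hp
    simp only [Set.mem_union, Set.mem_symmDiff, Set.mem_sdiff] at hp ⊢
    tauto

theorem Approx.limSet {A : ∀ n, Set (X n)} (hA : ∀ n, MeasurableSet (A n)) :
    Approx (limSet ω A) A := ⟨hA, by simpa using isNull_empty⟩

theorem Approx.compl {M : Set (SetUltralimit ω X)} {A : ∀ n, Set (X n)} (h : Approx M A) :
    Approx Mᶜ (fun n => (A n)ᶜ) := by
  refine ⟨fun n => (h.1 n).compl, h.2.mono ?_⟩
  rw [limSet_compl]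
  intro p hp
  simp only [Set.mem_symmDiff, Set.mem_compl_iff] at hp ⊢
  tauto

/-- A countable union of sets approximated by `A k` is approximated by a single `B`, whose mass is
the supremum of the masses of the finite unions. -/
theorem Approx.iUnion {M : ℕ → Set (SetUltralimit ω X)} {A : ℕ → ∀ n, Set (X n)}
    (h : ∀ k, Approx (M k) (A k)) :
    ∃ B, Approx (⋃ k, M k) B ∧
      limMass ω B = ⨆ k, limMass ω (fun n => Set.accumulate (fun j => A j n) k) := by
  set c : ℝ≥0∞ := ⨆ k, limMass ω (fun n => Set.accumulate (fun j => A j n) k) with hc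
  have hc1 : c ≤ 1 := iSup_le fun k => limMass_le_one _
  have hctop : c ≠ ∞ := (hc1.trans_lt ENNReal.one_lt_top).ne
  obtain ⟨B, hB, hcov, hBc⟩ := exists_cover A (fun k => (h k).1) c hctop (fun k => le_iSup
    (fun k => limMass ω (fun n => Set.accumulate (fun j => A j n) k)) k)
  have haccmeas : ∀ k n, MeasurableSet (Set.accumulate (fun j => A j n) k) := fun k n =>
    MeasurableSet.biUnion (Set.to_countable _) fun j _ => (h j).1 n
  have haccsub : ∀ k, MMSpace.limSet ω (fun n => Set.accumulate (fun j => A j n) k) ⊆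
      ⋃ j, MMSpace.limSet ω (A j) := by
    intro k
    induction k with
    | zero =>
      refine Set.subset_iUnion_of_subset 0 ?_
      simp
    | succ k ih =>
      simp only [Set.accumulate_succ]
      rw [limSet_union]
      exact Set.union_subset ih (Set.subset_iUnion (fun j => MMSpace.limSet ω (A j)) (k + 1))
  have haccB : ∀ k, MMSpace.limSet ω (fun n => Set.accumulate (fun j => A j n) k) ⊆
      MMSpace.limSet ω B := fun k => (haccsub k).trans (Set.iUnion_subset hcov)
  have hBeq : limMass ω B = c := le_antisymm hBc (iSup_le fun k => limMass_mono (haccB k))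
  have hdiff : IsNull (MMSpace.limSet ω B \ ⋃ j, MMSpace.limSet ω (A j)) := by
    intro ε hε
    obtain ⟨k, hk⟩ : ∃ k, c < limMass ω (fun n => Set.accumulate (fun j => A j n) k) + ε := by
      by_contra hcon
      push Not at hcon
      have h1 : c + ε ≤ c := by
        conv_lhs => rw [hc]
        rw [ENNReal.iSup_add]
        exact iSup_le hcon
      exact absurd h1 (not_le.2 (ENNReal.lt_add_right hctop hε.ne'))
    refine ⟨fun n => B n \ Set.accumulate (fun j => A j n) k,
      fun n => (hB n).diff (haccmeas k n), ?_, ?_⟩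
    · rw [limSet_diff]
      exact Set.sdiff_subset_sdiff_right (haccsub k)
    · have h2 := limMass_union_add_inter (ω := ω)
        (fun n => B n \ Set.accumulate (fun j => A j n) k) (haccmeas k)
      have h3 : limMass ω (fun n => (B n \ Set.accumulate (fun j => A j n) k) ∩
          Set.accumulate (fun j => A j n) k) = 0 := by
        simp only [Set.sdiff_inter_self, limMass_empty]
      have h4 : limMass ω (fun n => (B n \ Set.accumulate (fun j => A j n) k) ∪
          Set.accumulate (fun j => A j n) k) ≤ limMass ω B := by
        refine limMass_mono ?_
        rw [limSet_union, limSet_diff]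
        exact Set.union_subset Set.sdiff_subset (haccB k)
      rw [h3, add_zero] at h2
      rw [h2, hBeq] at h4
      have h5 := h4.trans_lt hk
      rw [add_comm] at h5
      exact lt_of_add_lt_add_left h5
  refine ⟨B, ⟨hB, ((IsNull.iUnion fun k => (h k).2).union hdiff).mono ?_⟩, hBeq⟩
  intro p hp
  simp only [Set.mem_union, Set.mem_symmDiff, Set.mem_sdiff, Set.mem_iUnion] at hp ⊢
  rcases hp with ⟨h1, h2⟩ | ⟨⟨j, h1⟩, h2⟩
  · by_cases hex : ∃ j, p ∈ MMSpace.limSet ω (A j)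
    · obtain ⟨j, hj⟩ := hex
      exact Or.inl ⟨j, Or.inl ⟨hj, fun hM => h2 ⟨j, hM⟩⟩⟩
    · exact Or.inr ⟨h1, hex⟩
  · exact Or.inl ⟨j, Or.inr ⟨h1, fun hA => h2 (hcov j hA)⟩⟩

/-- The σ-algebra of measurable sets of the set-theoretical ultralimit: the sets that differ from
an ultralimit of measurable sets by a nullset. -/
instance : MeasurableSpace (SetUltralimit ω X) where
  MeasurableSet' M := ∃ A : ∀ n, Set (X n), Approx M A
  measurableSet_empty := ⟨fun _ => ∅, by
    simpa only [limSet_empty] using Approx.limSet (ω := ω) (X := X) (fun _ => MeasurableSet.empty)⟩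
  measurableSet_compl _ := fun ⟨A, hA⟩ => ⟨fun n => (A n)ᶜ, hA.compl⟩
  measurableSet_iUnion M hM := by
    choose A hA using hM
    obtain ⟨B, hB, -⟩ := Approx.iUnion hA
    exact ⟨B, hB⟩

theorem measurableSet_iff {M : Set (SetUltralimit ω X)} :
    MeasurableSet M ↔ ∃ A : ∀ n, Set (X n), Approx M A := Iff.rfl

theorem limMass_accumulate {M : ℕ → Set (SetUltralimit ω X)} {A : ℕ → ∀ n, Set (X n)}
    (h : ∀ k, Approx (M k) (A k)) (hd : Pairwise (Function.onFun Disjoint M)) (k : ℕ) :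
    limMass ω (fun n => Set.accumulate (fun j => A j n) k) =
      ∑ j ∈ Finset.range (k + 1), limMass ω (A j) := by
  induction k with
  | zero => simp
  | succ k ih =>
    rw [Finset.sum_range_succ, ← ih, ← limMass_union_add_inter _ (h (k + 1)).1]
    have h0 : limMass ω (fun n => Set.accumulate (fun j => A j n) k ∩ A (k + 1) n) = 0 := by
      refine limMass_eq_zero ((IsNull.iUnion fun j => (h j).2).mono ?_)
      rintro p hp
      rw [limSet_inter] at hp
      obtain ⟨h1, h2⟩ := hp
      obtain ⟨x, rfl⟩ := cls_surjective p
      rw [cls_mem_limSet] at h1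
      have h3 : ∃ j ≤ k, cls ω x ∈ MMSpace.limSet ω (A j) := by
        by_contra hcon
        push Not at hcon
        have : ∀ᶠ n in (ω : Filter ℕ), ∀ j ∈ Set.Iic k, x n ∉ A j n :=
          (eventually_all_finite (Set.finite_Iic k)).2 fun j hj =>
            Ultrafilter.eventually_not.2 fun hh => hcon j hj (cls_mem_limSet.2 hh)
        obtain ⟨n, hn1, hn2⟩ := (h1.and this).exists
        obtain ⟨j, hj, hxj⟩ := Set.mem_accumulate.1 hn1
        exact hn2 j hj hxj
      obtain ⟨j, hj, hxj⟩ := h3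
      have hdis := Set.disjoint_left.1 (hd (show j ≠ k + 1 by omega))
      simp only [Set.mem_iUnion, Set.mem_symmDiff]
      by_cases hM : cls ω x ∈ M j
      · exact ⟨k + 1, Or.inl ⟨h2, hdis hM⟩⟩
      · exact ⟨j, Or.inl ⟨hxj, hM⟩⟩
    rw [h0, add_zero]
    simp only [Set.accumulate_succ]

/-- The ultralimit measure: a measurable set has the mass of an ultralimit set from which it
differs by a nullset. -/
noncomputable def ultraMeasure (ω : Ultrafilter ℕ) (X : ℕ → MMSpace.{u}) :
    Measure (SetUltralimit ω X) :=
  Measure.ofMeasurable (fun _ hM => limMass ω (Classical.choose (measurableSet_iff.1 hM)))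
    (by
      rw [← limMass_empty (ω := ω) (X := X)]
      refine (Classical.choose_spec (measurableSet_iff.1 MeasurableSet.empty)).limMass_eq ?_
      simpa only [limSet_empty] using
        Approx.limSet (ω := ω) (X := X) (fun _ => MeasurableSet.empty))
    (by
      intro M hM hd
      have hA := fun k => Classical.choose_spec (measurableSet_iff.1 (hM k))
      obtain ⟨B, hB, hBm⟩ := Approx.iUnion hA
      rw [(Classical.choose_spec (measurableSet_iff.1 (MeasurableSet.iUnion hM))).limMass_eq hB,
        hBm, ENNReal.tsum_eq_iSup_nat' (tendsto_add_atTop_nat 1)]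
      exact iSup_congr fun k => limMass_accumulate hA hd k)

theorem ultraMeasure_eq {M : Set (SetUltralimit ω X)} {A : ∀ n, Set (X n)} (h : Approx M A) :
    ultraMeasure ω X M = limMass ω A := by
  have hM : MeasurableSet M := ⟨A, h⟩
  rw [ultraMeasure, Measure.ofMeasurable_apply M hM]
  exact (Classical.choose_spec (measurableSet_iff.1 hM)).limMass_eq h

/-! ### The metric ultralimit -/

/-- The metric ultralimit: sequences are identified when `lim_ω d(x n, y n) = 0`. -/
def MetricUltralimit (ω : Ultrafilter ℕ) (X : ℕ → MMSpace.{u}) : Type u :=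
  SeparationQuotient (SetUltralimit ω X)

noncomputable instance : MetricSpace (MetricUltralimit ω X) :=
  inferInstanceAs (MetricSpace (SeparationQuotient (SetUltralimit ω X)))

/-- The natural projection of the set-theoretical onto the metric ultralimit. -/
noncomputable def proj (ω : Ultrafilter ℕ) (X : ℕ → MMSpace.{u}) : SetUltralimit ω X → MetricUltralimit ω X :=
  SeparationQuotient.mk

theorem proj_surjective : Function.Surjective (proj ω X) := SeparationQuotient.surjective_mk

theorem dist_proj (x y : ∀ n, X n) :
    dist (proj ω X (cls ω x)) (proj ω X (cls ω y)) =
      limUnder (ω : Filter ℕ) fun n => dist (x n) (y n) := rfl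

/-- Admissible sets: those whose preimage in the set-theoretical ultralimit is measurable. -/
noncomputable instance : MeasurableSpace (MetricUltralimit ω X) :=
  MeasurableSpace.map (proj ω X) inferInstance

theorem measurable_proj : Measurable (proj ω X) := fun _ h => h

/-- The measure of the metric ultralimit, on the admissible sets. -/
noncomputable def ultralimitMeasure (ω : Ultrafilter ℕ) (X : ℕ → MMSpace.{u}) :
    Measure (MetricUltralimit ω X) :=
  (ultraMeasure ω X).map (proj ω X)

theorem ultralimitMeasure_apply {S : Set (MetricUltralimit ω X)} (hS : MeasurableSet S) :
    ultralimitMeasure ω X S = ultraMeasure ω X (proj ω X ⁻¹' S) :=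
  Measure.map_apply measurable_proj hS

/-- The support of the metric ultralimit: the points all of whose neighbourhoods have positive
measure. -/
def ultralimitSupport (ω : Ultrafilter ℕ) (X : ℕ → MMSpace.{u}) : Set (MetricUltralimit ω X) :=
  (ultralimitMeasure ω X).support

theorem mem_ultralimitSupport {p : MetricUltralimit ω X} :
    p ∈ ultralimitSupport ω X ↔
      ∀ ε : ℝ, 0 < ε → 0 < ultralimitMeasure ω X (Metric.closedBall p ε) := by
  refine (Measure.mem_support_iff_forall p).trans ⟨fun h ε hε => h _ (Metric.closedBall_mem_nhds p hε),
    fun h U hU => ?_⟩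
  obtain ⟨ε, hε, hsub⟩ := Metric.nhds_basis_closedBall.mem_iff.1 hU
  exact (h ε hε).trans_le (measure_mono hsub)

/-- The support of the metric ultralimit is isometric to the mm-space `Y` as a metric measure
space: there is an isometry of `Y` onto the support that carries the measure of `Y` to the
ultralimit measure on the support. -/
def SupportIsometricTo (ω : Ultrafilter ℕ) (X : ℕ → MMSpace.{u}) (Y : MMSpace.{v}) : Prop :=
  ∃ Φ : Y ≃ᵢ ultralimitSupport ω X, ∀ B : Set Y, MeasurableSet B →
    MeasurableSet ((fun y => (Φ y : MetricUltralimit ω X)) '' B) ∧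
      ultralimitMeasure ω X ((fun y => (Φ y : MetricUltralimit ω X)) '' B) = Y.μ B

end MMSpace

/-! From the support to box distance: cut `Y`, up to small mass, into finitely many disjoint cells
`B j` near centres `y j`. Their isometric images are measurable, so they contain ultralimits of sets
`A j n` of almost the same mass. By saturation, for `ω`-almost every `n` the `A j n` are disjoint
and their mutual distances are close to those of the centres. A coupling matching `A j n` with `B j`
(`exists_coupling_of_disjoint`), parametrised by `[0,1]`, bounds the box distance
(`boxDist_le_of_coupling`).

From box convergence to the support: take near-optimal parametrisations `Ψ n`, `Φ n` with
exceptional sets `S n` of measure tending to zero. By full support each `y` is a limit of points `Φ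
n (s n)` with `s n ∉ S n`; sending `y` to the class of `Ψ n (s n)` is an isometry `F`. Comparing
balls through the parameters shows that thickenings of `F '' C` have mass at least `Y.μ C`, and
shrinking them gives the same for `F '' C` with `C` closed. Since the total mass is one, this
domination is equality, and the closed full-measure set `Set.range F` is the support
(`supportIsometricTo_of_isometry`). The ultralimit may be nonseparable, so admissibility is obtained
from closed balls by countable operations only. -/

namespace MMSpace

/-! ### Couplings with prescribed marginals -/

section Coupling

variable {α : Type u} {β : Type v} [MeasurableSpace α] [MeasurableSpace β]

/-- A measure on a product whose marginals are dominated by probability measures `μ` and `ν`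
extends to a coupling of `μ` and `ν`. -/
theorem exists_coupling_ge (μ : Measure α) (ν : Measure β) [IsProbabilityMeasure μ]
    [IsProbabilityMeasure ν] (γ₀ : Measure (α × β)) (h₁ : γ₀.map Prod.fst ≤ μ)
    (h₂ : γ₀.map Prod.snd ≤ ν) :
    ∃ γ : Measure (α × β), γ₀ ≤ γ ∧ γ.map Prod.fst = μ ∧ γ.map Prod.snd = ν := by
  have hf₁ : IsFiniteMeasure (γ₀.map Prod.fst) := isFiniteMeasure_of_le μ h₁
  have hf₂ : IsFiniteMeasure (γ₀.map Prod.snd) := isFiniteMeasure_of_le ν h₂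
  set a := μ - γ₀.map Prod.fst with ha
  set b := ν - γ₀.map Prod.snd with hb
  have hfa : IsFiniteMeasure a := isFiniteMeasure_of_le μ Measure.sub_le
  have hfb : IsFiniteMeasure b := isFiniteMeasure_of_le ν Measure.sub_le
  have ea : a + γ₀.map Prod.fst = μ := Measure.sub_add_cancel_of_le h₁
  have eb : b + γ₀.map Prod.snd = ν := Measure.sub_add_cancel_of_le h₂
  have u₁ : γ₀.map Prod.fst Set.univ = γ₀ Set.univ := by
    rw [Measure.map_apply measurable_fst MeasurableSet.univ, Set.preimage_univ]
  have u₂ : γ₀.map Prod.snd Set.univ = γ₀ Set.univ := by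
    rw [Measure.map_apply measurable_snd MeasurableSet.univ, Set.preimage_univ]
  have hm : γ₀ Set.univ ≠ ∞ := u₁ ▸ measure_ne_top _ _
  have ma : a Set.univ + γ₀ Set.univ = 1 := by
    rw [← u₁, ← Measure.add_apply, ea, measure_univ]
  have mb : b Set.univ + γ₀ Set.univ = 1 := by
    rw [← u₂, ← Measure.add_apply, eb, measure_univ]
  have hab : a Set.univ = b Set.univ := by
    rw [← mb] at ma
    exact (ENNReal.add_left_inj hm).1 ma
  -- The defects `a` and `b` have equal mass, so their normalised product has them as marginals. If
  -- that mass is zero the factor is `∞`, but it multiplies the zero measure.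
  refine ⟨γ₀ + (a Set.univ)⁻¹ • a.prod b, Measure.le_add_right le_rfl, ?_, ?_⟩
  · rw [Measure.map_add _ _ measurable_fst, Measure.map_smul, Measure.map_fst_prod, smul_smul,
      ← hab]
    rcases eq_or_ne (a Set.univ) 0 with h0 | h0
    · rw [Measure.measure_univ_eq_zero.1 h0, zero_add] at ea
      rw [Measure.measure_univ_eq_zero.1 h0, smul_zero, add_zero, ea]
    · rw [ENNReal.inv_mul_cancel h0 (measure_ne_top _ _), one_smul, add_comm, ea]
  · rw [Measure.map_add _ _ measurable_snd, Measure.map_smul, Measure.map_snd_prod, smul_smul, hab]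
    rcases eq_or_ne (b Set.univ) 0 with h0 | h0
    · rw [Measure.measure_univ_eq_zero.1 h0, zero_add] at eb
      rw [Measure.measure_univ_eq_zero.1 h0, smul_zero, add_zero, eb]
    · rw [ENNReal.inv_mul_cancel h0 (measure_ne_top _ _), one_smul, add_comm, eb]

/-- A coupling matching up two finite families of disjoint sets as well as their masses allow. -/
theorem exists_coupling_of_disjoint {ι : Type*} (μ : Measure α) (ν : Measure β)
    [IsProbabilityMeasure μ] [IsProbabilityMeasure ν] (s : Finset ι) {A : ι → Set α}
    {B : ι → Set β} (hA : ∀ i, MeasurableSet (A i)) (hB : ∀ i, MeasurableSet (B i))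
    (dA : (s : Set ι).PairwiseDisjoint A) (dB : (s : Set ι).PairwiseDisjoint B) :
    ∃ γ : Measure (α × β), γ.map Prod.fst = μ ∧ γ.map Prod.snd = ν ∧
      ∑ i ∈ s, min (μ (A i)) (ν (B i)) ≤ γ (⋃ i ∈ s, A i ×ˢ B i) := by
  -- This weight gives block `i` exactly the mass `min (μ (A i)) (ν (B i))`; on null blocks it is `0
  -- / 0 = 0`.
  let c : ι → ℝ≥0∞ := fun i => min (μ (A i)) (ν (B i)) / (μ (A i) * ν (B i))
  have hc : ∀ i, c i * (μ (A i) * ν (B i)) = min (μ (A i)) (ν (B i)) := by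
    intro i
    refine ENNReal.div_mul_cancel' (fun h => ?_) fun h =>
      absurd h (ENNReal.mul_ne_top (measure_ne_top _ _) (measure_ne_top _ _))
    rcases mul_eq_zero.1 h with h | h <;> simp [h]
  have hc₁ : ∀ i, c i * ν (B i) ≤ 1 := by
    intro i
    rcases eq_or_ne (μ (A i)) 0 with h | h
    · simp [c, h]
    · rw [← ENNReal.mul_le_mul_iff_left h (measure_ne_top _ _), one_mul, mul_assoc,
        mul_comm (ν (B i)), hc]
      exact min_le_left _ _
  have hc₂ : ∀ i, c i * μ (A i) ≤ 1 := by
    intro i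
    rcases eq_or_ne (ν (B i)) 0 with h | h
    · simp [c, h]
    · rw [← ENNReal.mul_le_mul_iff_left h (measure_ne_top _ _), one_mul, mul_assoc, hc]
      exact min_le_right _ _
  let γ₀ : Measure (α × β) := ∑ i ∈ s, c i • (μ.restrict (A i)).prod (ν.restrict (B i))
  have hγ₀ : ∀ (S : Set α) (T : Set β), γ₀ (S ×ˢ T) =
      ∑ i ∈ s, c i * (μ.restrict (A i) S * ν.restrict (B i) T) := by
    intro S T
    simp only [γ₀, Measure.finsetSum_apply, Measure.smul_apply, Measure.prod_prod, smul_eq_mul]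
  -- Each marginal of block `i` is at most the restriction of `μ` or `ν` to one cell, by `hc₁` and
  -- `hc₂`; disjointness lets these restrictions add up.
  obtain ⟨γ, h, h₁, h₂⟩ := exists_coupling_ge μ ν γ₀ (by
    refine Measure.le_iff.2 fun S hS => ?_
    rw [Measure.map_apply measurable_fst hS, ← Set.prod_univ, hγ₀]
    calc ∑ i ∈ s, c i * (μ.restrict (A i) S * ν.restrict (B i) Set.univ)
        ≤ ∑ i ∈ s, μ.restrict (A i) S := Finset.sum_le_sum fun i _ => by
          rw [Measure.restrict_apply_univ, mul_left_comm]
          exact mul_le_of_le_one_right' (hc₁ i)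
      _ = μ.restrict (⋃ i ∈ s, A i) S := by
          rw [Measure.restrict_biUnion_finset dA hA, Measure.sum_apply _ hS, tsum_fintype]
          exact (Finset.sum_coe_sort s fun i => μ.restrict (A i) S).symm
      _ ≤ μ S := Measure.restrict_apply_le _ _) (by
    refine Measure.le_iff.2 fun S hS => ?_
    rw [Measure.map_apply measurable_snd hS, ← Set.univ_prod, hγ₀]
    calc ∑ i ∈ s, c i * (μ.restrict (A i) Set.univ * ν.restrict (B i) S)
        ≤ ∑ i ∈ s, ν.restrict (B i) S := Finset.sum_le_sum fun i _ => by
          rw [Measure.restrict_apply_univ, ← mul_assoc]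
          exact mul_le_of_le_one_left' (hc₂ i)
      _ = ν.restrict (⋃ i ∈ s, B i) S := by
          rw [Measure.restrict_biUnion_finset dB hB, Measure.sum_apply _ hS, tsum_fintype]
          exact (Finset.sum_coe_sort s fun i => ν.restrict (B i) S).symm
      _ ≤ ν S := Measure.restrict_apply_le _ _)
  refine ⟨γ, h₁, h₂, ?_⟩
  have hd : (s : Set ι).PairwiseDisjoint fun i => A i ×ˢ B i := fun i hi j hj hij =>
    Set.Disjoint.set_prod_left (dA hi hj hij) _ _
  rw [measure_biUnion_finset hd fun i _ => (hA i).prod (hB i)]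
  refine Finset.sum_le_sum fun i hi => ?_
  calc min (μ (A i)) (ν (B i)) = (c i • (μ.restrict (A i)).prod (ν.restrict (B i))) (A i ×ˢ B i) := by
        rw [Measure.smul_apply, Measure.prod_prod, Measure.restrict_apply_self,
          Measure.restrict_apply_self, smul_eq_mul, hc]
    _ ≤ γ₀ (A i ×ˢ B i) := by
        rw [hγ₀, Measure.smul_apply, Measure.prod_prod, smul_eq_mul]
        exact Finset.single_le_sum (f := fun j => c j * (μ.restrict (A j) (A i) * ν.restrict (B j) (B i)))
          (fun _ _ => zero_le) hi
    _ ≤ γ (A i ×ˢ B i) := h _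

end Coupling

/-! ### Bounding the box distance by couplings -/

instance (X : MMSpace.{u}) : SecondCountableTopology X :=
  UniformSpace.secondCountable_of_separable X

/-- The box distance is bounded through couplings: it suffices that the distances agree up to `ε`
on a set of pairs of mass at least `1 - ε`. -/
theorem boxDist_le_of_coupling (X : MMSpace.{u}) (Y : MMSpace.{v}) {ε : ℝ≥0} (γ : Measure (X × Y))
    (h₁ : γ.map Prod.fst = X.μ) (h₂ : γ.map Prod.snd = Y.μ) {G : Set (X × Y)}
    (hG : MeasurableSet G) (hm : 1 ≤ γ G + ε)
    (hd : ∀ p ∈ G, ∀ q ∈ G, |dist p.1 q.1 - dist p.2 q.2| ≤ ε) : boxDist X Y ≤ ε := by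
  have hγ : IsProbabilityMeasure γ := by
    refine ⟨?_⟩
    rw [← Set.preimage_univ (f := Prod.fst), ← Measure.map_apply measurable_fst MeasurableSet.univ,
      h₁, measure_univ]
  -- A Borel probability measure on a Polish space is an image of Lebesgue measure; the coordinates
  -- of `f` are the two parametrisations.
  obtain ⟨f, hf, hfm⟩ := Measure.exists_measurable_map_eq γ
  have hf₁ : MeasurePreserving (fun t => (f t).1) volume X.μ := by
    refine ⟨measurable_fst.comp hf, ?_⟩
    rw [← h₁, ← hfm, Measure.map_map measurable_fst hf]
    rfl
  have hf₂ : MeasurePreserving (fun t => (f t).2) volume Y.μ := by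
    refine ⟨measurable_snd.comp hf, ?_⟩
    rw [← h₂, ← hfm, Measure.map_map measurable_snd hf]
    rfl
  unfold boxDist boxFun
  refine iInf₂_le_of_le _ hf₁ (iInf₂_le_of_le _ hf₂ (iInf₂_le ε ?_))
  refine ⟨f ⁻¹' Gᶜ, hf hG.compl, ?_, fun s hs t ht => ?_⟩
  · rw [← Measure.map_apply hf hG.compl, hfm, prob_compl_eq_one_sub hG]
    exact tsub_le_iff_left.2 hm
  · exact hd _ (not_not.1 hs) _ (not_not.1 ht)

variable {ω : Ultrafilter ℕ} {X : ℕ → MMSpace.{u}} {Y : MMSpace.{v}}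

/-! ### From an isometric support to small box distance -/

/-- Saturation for bounds on distances. -/
theorem eventually_forall_abs_dist_sub_le {A B : ∀ n, Set (X n)} {c r r' : ℝ} (hr : r < r')
    (h : ∀ p ∈ limSet ω A, ∀ q ∈ limSet ω B, |dist p q - c| ≤ r) :
    ∀ᶠ n in (ω : Filter ℕ), ∀ x ∈ A n, ∀ y ∈ B n, |dist x y - c| ≤ r' := by
  by_contra hc
  rw [← Ultrafilter.eventually_not] at hc
  have : ∀ n, ∃ p : X n × X n, (¬ ∀ x ∈ A n, ∀ y ∈ B n, |dist x y - c| ≤ r') →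
      p.1 ∈ A n ∧ p.2 ∈ B n ∧ r' < |dist p.1 p.2 - c| := by
    intro n
    by_cases hn : ∀ x ∈ A n, ∀ y ∈ B n, |dist x y - c| ≤ r'
    · exact ⟨Classical.arbitrary _, fun h => (h hn).elim⟩
    · have hn' := hn
      push Not at hn'
      obtain ⟨x, hx, y, hy, hxy⟩ := hn'
      exact ⟨(x, y), fun _ => ⟨hx, hy, hxy⟩⟩
  choose p hp using this
  -- The counterexamples form two points of the ultralimit whose distance is off by at least `r' >
  -- r`.
  have h1 := h (cls ω fun n => (p n).1) (cls_mem_limSet.2 (hc.mono fun n hn => (hp n hn).1))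
    (cls ω fun n => (p n).2) (cls_mem_limSet.2 (hc.mono fun n hn => (hp n hn).2.1))
  have h2 := ((tendsto_dist_cls (ω := ω) (fun n => (p n).1) fun n => (p n).2).sub_const c).abs
  exact (hr.trans_le (ge_of_tendsto h2 (hc.mono fun n hn => (hp n hn).2.2.le))).not_ge h1

theorem dist_proj_proj (p q : SetUltralimit ω X) : dist (proj ω X p) (proj ω X q) = dist p q := rfl

/-- A measurable set contains ultralimits of measurable sets of almost the same mass. -/
theorem exists_limSet_subset {M : Set (SetUltralimit ω X)} (hM : MeasurableSet M) {δ : ℝ≥0∞}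
    (hδ : 0 < δ) : ∃ A : ∀ n, Set (X n), (∀ n, MeasurableSet (A n)) ∧ limSet ω A ⊆ M ∧
      ultraMeasure ω X M ≤ limMass ω A + δ := by
  obtain ⟨A, hA⟩ := hM
  obtain ⟨D, hD, hAD, hDδ⟩ := hA.2 δ hδ
  -- Removing the small cover `D` of the discrepancy turns approximation into inclusion.
  refine ⟨fun n => A n \ D n, fun n => (hA.1 n).diff (hD n), ?_, ?_⟩
  · rw [limSet_diff]
    rintro p ⟨hp, hpD⟩
    by_contra hpM
    exact hpD (hAD (Or.inl ⟨hp, hpM⟩))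
  · rw [ultraMeasure_eq hA]
    refine le_trans ?_ (add_le_add_right hDδ.le _)
    refine le_trans (limMass_mono ?_) (limMass_union_le _ _)
    rw [limSet_union, limSet_diff, Set.sdiff_union_self]
    exact Set.subset_union_left

/-- The factor 5 is spent on distances: `3 * δ` between `A i n`, `A j n` and the centres, `2 * δ`
between the centres and the cells of `Y`. The mass loss is only `2 * δ`. -/
theorem eventually_boxDist_le_of_supportIsometricTo (h : SupportIsometricTo ω X Y) {δ : ℝ≥0}
    (hδ : 0 < δ) : ∀ᶠ n in (ω : Filter ℕ), boxDist (X n) Y ≤ (5 * δ : ℝ≥0) := by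
  obtain ⟨Φ, hΦ⟩ := h
  set F : Y → MetricUltralimit ω X := fun y => Φ y
  have hF : Isometry F := isometry_subtype_coe.comp Φ.isometry
  have hδ0 : (0 : ℝ≥0∞) < δ := ENNReal.coe_pos.2 hδ
  let y : ℕ → Y := TopologicalSpace.denseSeq Y
  let B : ℕ → Set Y := disjointed fun j => Metric.closedBall (y j) δ
  have hBm : ∀ j, MeasurableSet (B j) := fun j =>
    MeasurableSet.disjointed (fun j => Metric.isClosed_closedBall.measurableSet) j
  have hBd : Pairwise (Function.onFun Disjoint B) := disjoint_disjointed _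
  have hBy : ∀ j, ∀ b ∈ B j, dist b (y j) ≤ δ := fun j b hb =>
    Metric.mem_closedBall.1 (disjointed_subset (fun j => Metric.closedBall (y j) δ) j hb)
  have hBu : ⋃ j, B j = Set.univ := by
    rw [iUnion_disjointed, Set.eq_univ_iff_forall]
    intro z
    obtain ⟨j, hj⟩ := (TopologicalSpace.denseRange_denseSeq Y).exists_dist_lt z
      (NNReal.coe_pos.2 hδ)
    exact Set.mem_iUnion.2 ⟨j, hj.le⟩
  have hBs : ∑' j, Y.μ (B j) = 1 := by
    rw [← measure_iUnion hBd hBm, hBu, measure_univ]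
  obtain ⟨J, hJ⟩ : ∃ J, 1 < ∑ j ∈ Finset.range J, Y.μ (B j) + δ := by
    have ht := (ENNReal.tendsto_nat_tsum fun j => Y.μ (B j)).add
      (tendsto_const_nhds (x := (δ : ℝ≥0∞)))
    rw [hBs] at ht
    exact (ht.eventually (lt_mem_nhds (ENNReal.lt_add_right ENNReal.one_ne_top hδ0.ne'))).exists
  -- A loss of `δ / J` in each of `J` cells totals at most `δ`.
  have hδJ : 0 < (δ : ℝ≥0∞) / J := ENNReal.div_pos hδ0.ne' (ENNReal.natCast_ne_top J)
  choose A hAm hAs hAB using fun j =>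
    exists_limSet_subset (ω := ω) (X := X) (hΦ (B j) (hBm j)).1 hδJ
  have hmass : ∀ j, Y.μ (B j) ≤ limMass ω (A j) + δ / J := fun j => by
    rw [← (hΦ (B j) (hBm j)).2, ultralimitMeasure_apply (hΦ (B j) (hBm j)).1]
    exact hAB j
  -- One `δ` pays for the discarded cells, the other for shrinking the images to ultralimit sets.
  have hsum : 1 < ∑ j ∈ Finset.range J, min (limMass ω (A j)) (Y.μ (B j)) + δ + δ := by
    refine hJ.trans_le ?_
    gcongr
    calc ∑ j ∈ Finset.range J, Y.μ (B j)
        ≤ ∑ j ∈ Finset.range J, (min (limMass ω (A j)) (Y.μ (B j)) + δ / J) := by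
          refine Finset.sum_le_sum fun j _ => ?_
          rw [← min_add_add_right]
          exact le_min (hmass j) le_self_add
      _ ≤ ∑ j ∈ Finset.range J, min (limMass ω (A j)) (Y.μ (B j)) + δ := by
          rw [Finset.sum_add_distrib, Finset.sum_const, Finset.card_range, nsmul_eq_mul]
          gcongr
          exact ENNReal.mul_div_le
  have hev₁ : ∀ᶠ n in (ω : Filter ℕ),
      1 < ∑ j ∈ Finset.range J, min ((X n).μ (A j n)) (Y.μ (B j)) + δ + δ :=
    (((tendsto_finsetSum _ fun j _ => (tendsto_limMass (A j)).min tendsto_const_nhds).add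
      tendsto_const_nhds).add tendsto_const_nhds).eventually (lt_mem_nhds hsum)
  have hev₂ : ∀ᶠ n in (ω : Filter ℕ), ∀ i ∈ Finset.range J, ∀ j ∈ Finset.range J,
      ∀ x ∈ A i n, ∀ x' ∈ A j n, |dist x x' - dist (y i) (y j)| ≤ 3 * δ := by
    simp only [eventually_all_finset]
    intro i _ j _
    refine eventually_forall_abs_dist_sub_le (r := 2 * δ)
      (by have := NNReal.coe_pos.2 hδ; linarith) fun p hp q hq => ?_
    obtain ⟨b, hb, hbp⟩ := hAs i hp
    obtain ⟨b', hb', hbq⟩ := hAs j hq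
    change F b = proj ω X p at hbp
    change F b' = proj ω X q at hbq
    rw [← dist_proj_proj, ← hbp, ← hbq, hF.dist_eq, ← Real.dist_eq]
    exact (dist_dist_dist_le _ _ _ _).trans (by linarith [hBy i b hb, hBy j b' hb'])
  have hev₃ : ∀ᶠ n in (ω : Filter ℕ), ∀ i ∈ Finset.range J, ∀ j ∈ Finset.range J,
      i ≠ j → Disjoint (A i n) (A j n) := by
    simp only [eventually_all_finset]
    intro i _ j _
    rw [eventually_imp_distrib_left]
    intro hij
    -- Distinct cells have disjoint images under the injective `F`; saturation brings this down to
    -- the `A j n`.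
    have hsub : limSet ω (fun n => A i n ∩ A j n) ⊆ limSet ω fun n => (∅ : Set (X n)) := by
      rw [limSet_inter]
      rintro p ⟨hp, hp'⟩
      obtain ⟨b, hb, hbp⟩ := hAs i hp
      obtain ⟨b', hb', hbp'⟩ := hAs j hp'
      have hbb : b = b' := hF.injective (hbp.trans hbp'.symm)
      exact (Set.disjoint_left.1 (hBd hij) hb (hbb ▸ hb')).elim
    exact (eventually_subset hsub).mono fun n hn => Set.disjoint_iff.2 hn
  filter_upwards [hev₁, hev₂, hev₃] with n h1 h2 h3
  obtain ⟨γ, hγ₁, hγ₂, hγ⟩ := exists_coupling_of_disjoint (X n).μ Y.μ (Finset.range J)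
    (fun j => hAm j n) hBm (fun i hi j hj hij => h3 i hi j hj hij) (fun i _ j _ hij => hBd hij)
  have hGm : MeasurableSet (⋃ j ∈ Finset.range J, A j n ×ˢ B j) :=
    Finset.measurableSet_biUnion _ fun j _ => (hAm j n).prod (hBm j)
  refine boxDist_le_of_coupling (X n) Y γ hγ₁ hγ₂ hGm ?_ ?_
  · refine h1.le.trans ?_
    rw [add_assoc]
    refine add_le_add hγ ?_
    rw [← ENNReal.coe_add, ENNReal.coe_le_coe, ← two_mul]
    gcongr
    norm_num
  · intro p hp q hq
    simp only [Set.mem_iUnion] at hp hq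
    obtain ⟨i, hi, hp1, hp2⟩ := hp
    obtain ⟨j, hj, hq1, hq2⟩ := hq
    have e1 := h2 i hi j hj _ hp1 _ hq1
    have e2 := dist_dist_dist_le (y i) (y j) p.2 q.2
    rw [Real.dist_eq, dist_comm (y i) p.2, dist_comm (y j) q.2] at e2
    have e3 := abs_sub_le (dist p.1 q.1) (dist (y i) (y j)) (dist p.2 q.2)
    push_cast
    linarith [hBy i _ hp2, hBy j _ hq2]

/-! ### Admissibility of balls and of isometric images -/

theorem measurableSet_limSet {A : ∀ n, Set (X n)} (hA : ∀ n, MeasurableSet (A n)) :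
    MeasurableSet (limSet ω A) := ⟨A, Approx.limSet hA⟩

theorem ultraMeasure_limSet {A : ∀ n, Set (X n)} (hA : ∀ n, MeasurableSet (A n)) :
    ultraMeasure ω X (limSet ω A) = limMass ω A := ultraMeasure_eq (Approx.limSet hA)

/-- Distances in `X n` may tend to `r` from above, so the preimage is a countable intersection of
ultralimits of slightly larger balls. -/
theorem measurableSet_closedBall (p : MetricUltralimit ω X) (r : ℝ) :
    MeasurableSet (Metric.closedBall p r) := by
  obtain ⟨p, rfl⟩ := proj_surjective p
  obtain ⟨x, rfl⟩ := cls_surjective p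
  have h : proj ω X ⁻¹' Metric.closedBall (proj ω X (cls ω x)) r =
      ⋂ k : ℕ, limSet ω fun n => Metric.closedBall (x n) (r + 1 / ((k : ℝ) + 1)) := by
    ext q
    obtain ⟨y, rfl⟩ := cls_surjective q
    simp only [Set.mem_preimage, Metric.mem_closedBall, Set.mem_iInter, cls_mem_limSet,
      dist_proj_proj]
    constructor
    · intro h k
      have hk : dist (cls ω y) (cls ω x) < r + 1 / ((k : ℝ) + 1) :=
        h.trans_lt (lt_add_of_pos_right _ Nat.one_div_pos_of_nat)
      exact ((tendsto_dist_cls y x).eventually (gt_mem_nhds hk)).mono fun n hn => hn.le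
    · intro h
      have h0 : Tendsto (fun k : ℕ => r + 1 / ((k : ℝ) + 1)) atTop (𝓝 (r + 0)) :=
        tendsto_const_nhds.add tendsto_one_div_add_atTop_nhds_zero_nat
      rw [add_zero] at h0
      exact ge_of_tendsto' h0 fun k => le_of_tendsto (tendsto_dist_cls y x) (h k)
  change MeasurableSet (proj ω X ⁻¹' Metric.closedBall (proj ω X (cls ω x)) r)
  rw [h]
  exact MeasurableSet.iInter fun k =>
    measurableSet_limSet fun n => Metric.isClosed_closedBall.measurableSet

instance : IsProbabilityMeasure (ultralimitMeasure ω X) := by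
  refine ⟨?_⟩
  have h : limSet ω (fun n => (Set.univ : Set (X n))) = Set.univ := by
    ext p
    obtain ⟨x, rfl⟩ := cls_surjective p
    simp [cls_mem_limSet]
  rw [ultralimitMeasure_apply MeasurableSet.univ, Set.preimage_univ, ← h,
    ultraMeasure_limSet fun _ => MeasurableSet.univ]
  exact tendsto_nhds_unique (tendsto_limMass _) (by simp)

theorem eq_iInter_iUnion_closedBall {α : Type*} [PseudoMetricSpace α] {Z : Set α} (hZ : IsClosed Z)
    {d : ℕ → α} (hd : ∀ j, d j ∈ Z) (hdense : Z ⊆ closure (Set.range d)) :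
    Z = ⋂ k : ℕ, ⋃ j, Metric.closedBall (d j) (1 / ((k : ℝ) + 1)) := by
  ext z
  simp only [Set.mem_iInter, Set.mem_iUnion, Metric.mem_closedBall]
  constructor
  · intro hz k
    obtain ⟨_, ⟨j, rfl⟩, hj⟩ := Metric.mem_closure_iff.1 (hdense hz) (1 / ((k : ℝ) + 1))
      Nat.one_div_pos_of_nat
    exact ⟨j, hj.le⟩
  · intro h
    rw [← hZ.closure_eq, Metric.mem_closure_iff]
    intro ε hε
    obtain ⟨k, hk⟩ := exists_nat_one_div_lt hε
    obtain ⟨j, hj⟩ := h k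
    exact ⟨d j, hd j, hj.trans_lt hk⟩

theorem exists_dense_seq_of_nonempty {α : Type*} [TopologicalSpace α] [SecondCountableTopology α]
    {C : Set α} (hC : C.Nonempty) :
    ∃ d : ℕ → α, (∀ j, d j ∈ C) ∧ C ⊆ closure (Set.range d) := by
  have := hC.to_subtype
  refine ⟨fun j => TopologicalSpace.denseSeq C j, fun j => Subtype.coe_prop _, fun z hz => ?_⟩
  have h : (⟨z, hz⟩ : C) ∈ closure (Set.range (TopologicalSpace.denseSeq C)) :=
    TopologicalSpace.denseRange_denseSeq C _
  have h' := image_closure_subset_closure_image continuous_subtype_val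
    (Set.mem_image_of_mem Subtype.val h)
  rwa [← Set.range_comp] at h'

/-- Images of closed sets under an isometry are countable intersections of countable unions of
balls. -/
theorem _root_.Isometry.image_eq_iInter_iUnion_closedBall {α β : Type*} [MetricSpace α]
    [CompleteSpace α] [MetricSpace β] {F : α → β} (hF : Isometry F) {C : Set α} (hC : IsClosed C)
    {d : ℕ → α} (hd : ∀ j, d j ∈ C) (hdense : C ⊆ closure (Set.range d)) :
    F '' C = ⋂ k : ℕ, ⋃ j, Metric.closedBall (F (d j)) (1 / ((k : ℝ) + 1)) := by
  refine eq_iInter_iUnion_closedBall (hF.isClosedEmbedding.isClosedMap C hC)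
    (fun j => Set.mem_image_of_mem F (hd j)) ?_
  refine (Set.image_mono hdense).trans ((image_closure_subset_closure_image hF.continuous).trans ?_)
  rw [← Set.range_comp]
  rfl

theorem measurableSet_image_of_isometry {F : Y → MetricUltralimit ω X} (hF : Isometry F) {B : Set Y}
    (hB : MeasurableSet B) : MeasurableSet (F '' B) := by
  have hcl : ∀ C : Set Y, IsClosed C → MeasurableSet (F '' C) := by
    intro C hC
    rcases C.eq_empty_or_nonempty with rfl | hne
    · simp
    obtain ⟨d, hd, hdense⟩ := exists_dense_seq_of_nonempty hne
    rw [hF.image_eq_iInter_iUnion_closedBall hC hd hdense]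
    exact MeasurableSet.iInter fun k => MeasurableSet.iUnion fun j => measurableSet_closedBall _ _
  -- Closed sets generate the Borel sets, so every Borel set is `F ⁻¹' T` with `T` admissible, and
  -- its image is `T ∩ Set.range F`.
  have hle : (inferInstance : MeasurableSpace Y) ≤ MeasurableSpace.comap F inferInstance := by
    rw [BorelSpace.measurable_eq (α := Y), borel_eq_generateFrom_isClosed]
    exact MeasurableSpace.generateFrom_le fun C hC =>
      ⟨F '' C, hcl C hC, Set.preimage_image_eq C hF.injective⟩
  obtain ⟨T, hT, rfl⟩ := hle B hB
  rw [Set.image_preimage_eq_inter_range, ← Set.image_univ]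
  exact hT.inter (hcl _ isClosed_univ)

/-! ### Recognising the support from closed sets -/

/-- A probability measure dominated on closed sets by a subprobability measure equals it. -/
theorem eq_of_forall_isClosed_le {α : Type*} [PseudoEMetricSpace α] [MeasurableSpace α]
    [BorelSpace α] {μ ν : Measure α} [IsProbabilityMeasure μ] (hν : ν Set.univ ≤ 1)
    (h : ∀ C, IsClosed C → μ C ≤ ν C) : ν = μ := by
  have hν1 : IsProbabilityMeasure ν :=
    ⟨le_antisymm hν (by simpa using h Set.univ isClosed_univ)⟩
  refine ext_of_generate_finite _ (BorelSpace.measurable_eq.trans borel_eq_generateFrom_isClosed)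
    isPiSystem_isClosed (fun C hC => le_antisymm ?_ (h C hC)) (by simp)
  have hC' : IsClosed C := hC
  -- An open set is an increasing union of closed ones, so domination passes to open sets;
  -- complements then reverse it.
  have hop : μ Cᶜ ≤ ν Cᶜ := by
    obtain ⟨F, hF, -, hFU, hmono⟩ := hC'.isOpen_compl.exists_iUnion_isClosed
    rw [← hFU, hmono.measure_iUnion, hmono.measure_iUnion]
    exact iSup_mono fun n => h _ (hF n)
  rw [← compl_compl C, prob_compl_eq_one_sub hC'.measurableSet.compl,
    prob_compl_eq_one_sub hC'.measurableSet.compl]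
  exact tsub_le_tsub_left hop 1

/-- An isometry that does not decrease the measures of closed sets is onto the support and preserves
measures. -/
theorem supportIsometricTo_of_isometry {F : Y → MetricUltralimit ω X} (hF : Isometry F)
    (h : ∀ C : Set Y, IsClosed C → Y.μ C ≤ ultralimitMeasure ω X (F '' C)) :
    SupportIsometricTo ω X Y := by
  have himg : ∀ B : Set Y, MeasurableSet B → MeasurableSet (F '' B) := fun B hB =>
    measurableSet_image_of_isometry hF hB
  have hcomap : ∀ B : Set Y, MeasurableSet B →
      (ultralimitMeasure ω X).comap F B = ultralimitMeasure ω X (F '' B) := fun B hB =>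
    Measure.comap_apply F hF.injective himg _ hB
  have heq : (ultralimitMeasure ω X).comap F = Y.μ := by
    refine eq_of_forall_isClosed_le ?_ fun C hC => ?_
    · rw [hcomap _ MeasurableSet.univ]
      exact prob_le_one
    · rw [hcomap _ hC.measurableSet]
      exact h C hC
  have hmeas : ∀ B : Set Y, MeasurableSet B → ultralimitMeasure ω X (F '' B) = Y.μ B := fun B hB => by
    rw [← hcomap B hB, heq]
  have hmem : ∀ y, F y ∈ ultralimitSupport ω X := by
    intro y
    rw [mem_ultralimitSupport]
    intro ε hε
    refine (Metric.measure_closedBall_pos Y.μ y hε).trans_le ?_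
    rw [← hmeas _ Metric.isClosed_closedBall.measurableSet]
    refine measure_mono ?_
    rintro _ ⟨z, hz, rfl⟩
    rw [Metric.mem_closedBall, hF.dist_eq]
    exact hz
  have hsurj : Function.Surjective fun y => (⟨F y, hmem y⟩ : ultralimitSupport ω X) := by
    rintro ⟨p, hp⟩
    by_contra hc
    have hpF : p ∈ (Set.range F)ᶜ := by
      rintro ⟨y, rfl⟩
      exact hc ⟨y, rfl⟩
    -- Completeness of `Y` makes the range closed, so `p` has a ball inside its complement, which is
    -- null.
    obtain ⟨ε, hε, hsub⟩ := Metric.nhds_basis_closedBall.mem_iff.1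
      (hF.isClosedEmbedding.isClosed_range.isOpen_compl.mem_nhds hpF)
    refine (mem_ultralimitSupport.1 hp ε hε).ne' (measure_mono_null hsub ?_)
    rw [← Set.image_univ, prob_compl_eq_zero_iff (himg _ MeasurableSet.univ),
      hmeas _ MeasurableSet.univ, measure_univ]
  refine ⟨⟨Equiv.ofBijective _ ⟨fun a b hab => hF.injective (congrArg Subtype.val hab), hsurj⟩,
    fun a b => hF a b⟩, fun B hB => ⟨himg B hB, hmeas B hB⟩⟩

/-! ### From box convergence to an isometric support -/

theorem boxDist_le_one (X : MMSpace.{u}) (Y : MMSpace.{v}) : boxDist X Y ≤ 1 := by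
  have h := boxDist_le_of_coupling X Y (ε := 1) (X.μ.prod Y.μ) (by simp) (by simp)
    MeasurableSet.empty (by simp) (by simp)
  simpa using h

theorem exists_of_boxDist_lt {X : MMSpace.{u}} {Y : MMSpace.{v}} {ε : ℝ≥0}
    (h : boxDist X Y < ε) : ∃ (Ψ₁ : I → X) (Ψ₂ : I → Y), MeasurePreserving Ψ₁ volume X.μ ∧
      MeasurePreserving Ψ₂ volume Y.μ ∧ BoxClose ε (X.pullDist Ψ₁) (Y.pullDist Ψ₂) := by
  simp only [boxDist, boxFun, iInf_lt_iff] at h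
  obtain ⟨Ψ₁, h₁, Ψ₂, h₂, ε', ⟨S, hS, hSm, hd⟩, hlt⟩ := h
  exact ⟨Ψ₁, Ψ₂, h₁, h₂, S, hS, hSm.trans hlt.le,
    fun s hs t ht => (hd s hs t ht).trans (by exact_mod_cast hlt.le)⟩

/-- One near-minimiser competes with every `t ∈ T`, so a single sequence serves all radii without a
diagonal choice. For empty `T` the point is arbitrary. -/
theorem exists_almost_minimizer {α : Type*} [Nonempty α] (T : Set α) {f : α → ℝ} (hf : ∀ a, 0 ≤ f a)
    {ε : ℝ} (hε : 0 < ε) : ∃ a, ∀ t ∈ T, a ∈ T ∧ f a ≤ f t + ε := by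
  rcases T.eq_empty_or_nonempty with rfl | hT
  · exact ⟨Classical.arbitrary α, by simp⟩
  · obtain ⟨_, ⟨a, ha, rfl⟩, hlt⟩ := exists_lt_of_csInf_lt (hT.image f) (lt_add_of_pos_right _ hε)
    refine ⟨a, fun t ht => ⟨ha, hlt.le.trans ?_⟩⟩
    gcongr
    refine csInf_le ⟨0, ?_⟩ ⟨t, ht, rfl⟩
    rintro _ ⟨b, -, rfl⟩
    exact hf b

/-- Points of `Y` are limits of images of parameters outside of small exceptional sets. -/
theorem exists_tendsto_param {Φ : ℕ → I → Y} (hΦ : ∀ n, MeasurePreserving (Φ n) volume Y.μ)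
    {S : ℕ → Set I} {e : ℕ → ℝ≥0} (hSe : ∀ n, volume (S n) ≤ e n) (he : Tendsto e atTop (𝓝 0))
    (y : Y) : ∃ s : ℕ → I, (∀ᶠ n in atTop, s n ∉ S n) ∧
      Tendsto (fun n => dist (Φ n (s n)) y) atTop (𝓝 0) := by
  have hex : ∀ r : ℝ, 0 < r → ∀ᶠ n in atTop, ∃ t ∈ (S n)ᶜ, dist (Φ n t) y < r := by
    intro r hr
    -- Full support: once `e n` is below the mass of this ball, its preimage cannot lie inside `S
    -- n`.
    have hpos := Metric.measure_ball_pos Y.μ y hr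
    have he' : Tendsto (fun n => (e n : ℝ≥0∞)) atTop (𝓝 0) := by
      simpa using ENNReal.tendsto_coe.2 he
    filter_upwards [he'.eventually (gt_mem_nhds hpos)] with n hn
    by_contra hc
    push Not at hc
    have hsub : Φ n ⁻¹' Metric.ball y r ⊆ S n := fun t ht => by
      by_contra htS
      exact (hc t htS).not_gt ht
    have := measure_mono (μ := volume) hsub
    rw [(hΦ n).measure_preimage Metric.isOpen_ball.measurableSet.nullMeasurableSet] at this
    exact (this.trans (hSe n)).not_gt hn
  choose s hs using fun n : ℕ => exists_almost_minimizer (S n)ᶜ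
    (f := fun t => dist (Φ n t) y) (fun _ => dist_nonneg)
    (Nat.one_div_pos_of_nat (α := ℝ) (n := n))
  refine ⟨s, (hex 1 one_pos).mono fun n ⟨t, ht, _⟩ => (hs n t ht).1, ?_⟩
  rw [Metric.tendsto_nhds]
  intro r hr
  filter_upwards [hex (r / 2) (half_pos hr), tendsto_one_div_add_atTop_nhds_zero_nat.eventually
    (gt_mem_nhds (half_pos hr))] with n ⟨t, ht, htr⟩ hn
  rw [Real.dist_eq, sub_zero, abs_of_nonneg dist_nonneg]
  linarith [(hs n t ht).2]

theorem supportIsometricTo_of_tendsto (hω : (ω : Filter ℕ) ≤ atTop)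
    (h : Tendsto (fun n => boxDist (X n) Y) atTop (𝓝 0)) : SupportIsometricTo ω X Y := by
  have hfin : ∀ n, boxDist (X n) Y ≠ ∞ := fun n =>
    ((boxDist_le_one _ _).trans_lt ENNReal.one_lt_top).ne
  -- The extra term makes `e n` strictly larger than the infimum, which need not be attained.
  let e : ℕ → ℝ≥0 := fun n => (boxDist (X n) Y).toNNReal + 1 / ((n : ℝ≥0) + 1)
  have he : Tendsto e atTop (𝓝 0) := by
    have h1 := (ENNReal.tendsto_toNNReal ENNReal.zero_ne_top).comp h
    simpa [e] using h1.add (tendsto_one_div_add_atTop_nhds_zero_nat (𝕜 := ℝ≥0))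
  have hlt : ∀ n, boxDist (X n) Y < e n := by
    intro n
    conv_lhs => rw [← ENNReal.coe_toNNReal (hfin n)]
    exact ENNReal.coe_lt_coe.2 (lt_add_of_pos_right _ Nat.one_div_pos_of_nat)
  choose Ψ Φ hΨ hΦ S hS hSe hd using fun n => exists_of_boxDist_lt (hlt n)
  choose s hsS hsy using exists_tendsto_param hΦ hSe he
  have heR : Tendsto (fun n => (e n : ℝ)) atTop (𝓝 0) := by
    simpa using NNReal.tendsto_coe.2 he
  let x : Y → ∀ n, X n := fun y n => Ψ n (s y n)
  let F : Y → MetricUltralimit ω X := fun y => proj ω X (cls ω (x y))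
  have hF : Isometry F := by
    refine Isometry.of_dist_eq fun y y' => ?_
    refine tendsto_nhds_unique (tendsto_dist_cls (x y) (x y')) (Tendsto.mono_left ?_ hω)
    rw [tendsto_iff_dist_tendsto_zero]
    have hz : Tendsto (fun n => (e n : ℝ) + (dist (Φ n (s y n)) y + dist (Φ n (s y' n)) y')) atTop
        (𝓝 0) := by
      simpa using heR.add ((hsy y).add (hsy y'))
    refine squeeze_zero' (Eventually.of_forall fun _ => dist_nonneg) ?_ hz
    filter_upwards [hsS y, hsS y'] with n h1 h2
    refine (dist_triangle _ (dist (Φ n (s y n)) (Φ n (s y' n))) _).trans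
      (add_le_add ?_ (dist_dist_dist_le _ _ _ _))
    rw [Real.dist_eq]
    exact hd n _ h1 _ h2
  -- The radius grows from `r / 2` to `r`: `r / 4` for replacing `d j` by `Φ n (s (d j) n)`, and `r
  -- / 4` for `e n`. Finitely many centres are needed so that one tail of indices serves them all.
  have hball : ∀ (d : ℕ → Y) (r : ℝ), 0 < r → ∀ k,
      Y.μ (Set.accumulate (fun j => Metric.ball (d j) (r / 2)) k) ≤
        limMass ω fun n => Set.accumulate (fun j => Metric.closedBall (x (d j) n) r) k := by
    intro d r hr k
    have he' : Tendsto (fun n => (e n : ℝ≥0∞)) (ω : Filter ℕ) (𝓝 0) := by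
      simpa using (ENNReal.tendsto_coe.2 he).mono_left hω
    have ht := (tendsto_limMass (ω := ω) fun n =>
      Set.accumulate (fun j => Metric.closedBall (x (d j) n) r) k).add he'
    rw [add_zero] at ht
    refine ge_of_tendsto ht (Eventually.filter_mono hω ?_)
    have hev : ∀ᶠ n in atTop, ∀ j ∈ Set.Iic k,
        s (d j) n ∉ S n ∧ dist (Φ n (s (d j) n)) (d j) < r / 4 := by
      refine (eventually_all_finite (Set.finite_Iic k)).2 fun j _ => (hsS (d j)).and ?_
      exact (hsy (d j)).eventually (gt_mem_nhds (by linarith))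
    filter_upwards [hev, heR.eventually (gt_mem_nhds (show 0 < r / 4 by linarith))] with n hn hen
    have hm₁ : MeasurableSet (Set.accumulate (fun j => Metric.ball (d j) (r / 2)) k) :=
      MeasurableSet.biUnion (Set.to_countable _) fun j _ => Metric.isOpen_ball.measurableSet
    have hm₂ : MeasurableSet (Set.accumulate (fun j => Metric.closedBall (x (d j) n) r) k) :=
      MeasurableSet.biUnion (Set.to_countable _) fun j _ => Metric.isClosed_closedBall.measurableSet
    rw [← (hΦ n).measure_preimage hm₁.nullMeasurableSet,
      ← (hΨ n).measure_preimage hm₂.nullMeasurableSet]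
    refine (measure_mono ?_).trans ((measure_union_le _ _).trans (add_le_add_right (hSe n) _))
    intro t ht
    by_cases htS : t ∈ S n
    · exact Or.inr htS
    obtain ⟨j, hj, htj⟩ := Set.mem_accumulate.1 ht
    obtain ⟨h1, h2⟩ := hn j hj
    refine Or.inl (Set.mem_accumulate.2 ⟨j, hj, ?_⟩)
    have h3 : dist (Φ n t) (d j) < r / 2 := htj
    have h4 : |dist (Ψ n t) (Ψ n (s (d j) n)) - dist (Φ n t) (Φ n (s (d j) n))| ≤ e n :=
      hd n t htS _ h1
    have h5 := dist_triangle_right (Φ n t) (Φ n (s (d j) n)) (d j)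
    change dist (Ψ n t) (Ψ n (s (d j) n)) ≤ r
    linarith [(abs_le.1 h4).2]
  refine supportIsometricTo_of_isometry hF fun C hC => ?_
  rcases C.eq_empty_or_nonempty with rfl | hne
  · simp
  obtain ⟨d, hdC, hdense⟩ := exists_dense_seq_of_nonempty hne
  have hthick : ∀ r : ℝ, 0 < r →
      Y.μ C ≤ ultralimitMeasure ω X (⋃ j, Metric.closedBall (F (d j)) r) := by
    intro r hr
    calc Y.μ C ≤ Y.μ (⋃ j, Metric.ball (d j) (r / 2)) := by
          refine measure_mono fun z hz => ?_
          obtain ⟨_, ⟨j, rfl⟩, hj⟩ := Metric.mem_closure_iff.1 (hdense hz) (r / 2) (half_pos hr)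
          exact Set.mem_iUnion.2 ⟨j, hj⟩
      _ = ⨆ k, Y.μ (Set.accumulate (fun j => Metric.ball (d j) (r / 2)) k) :=
          measure_iUnion_eq_iSup_accumulate
      _ ≤ ultralimitMeasure ω X (⋃ j, Metric.closedBall (F (d j)) r) := by
          refine iSup_le fun k => (hball d r hr k).trans ?_
          rw [ultralimitMeasure_apply (MeasurableSet.iUnion fun j => measurableSet_closedBall _ _),
            ← ultraMeasure_limSet]
          swap
          · exact fun n => MeasurableSet.biUnion (Set.to_countable _) fun j _ =>
              Metric.isClosed_closedBall.measurableSet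
          refine measure_mono fun p hp => ?_
          obtain ⟨z, rfl⟩ := cls_surjective p
          rw [cls_mem_limSet] at hp
          simp only [Set.mem_accumulate] at hp
          -- Among finitely many balls the ultrafilter selects one that contains `z n` for
          -- `ω`-almost every `n`.
          obtain ⟨j, -, hj⟩ := (Ultrafilter.eventually_exists_mem_iff (Set.finite_Iic k)).1 hp
          exact Set.mem_iUnion.2 ⟨j, le_of_tendsto (tendsto_dist_cls z (x (d j))) hj⟩
  rw [hF.image_eq_iInter_iUnion_closedBall hC hdC hdense]
  -- Continuity from above, along the thickenings of radius `1 / (k + 1)`.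
  refine ge_of_tendsto' (tendsto_measure_iInter_atTop (fun k => (MeasurableSet.iUnion fun j =>
    measurableSet_closedBall _ _).nullMeasurableSet) ?_ ⟨0, measure_ne_top _ _⟩)
    fun k => hthick _ Nat.one_div_pos_of_nat
  exact fun k l hkl => Set.iUnion_mono fun j =>
    Metric.closedBall_subset_closedBall (Nat.one_div_le_one_div hkl)

end MMSpace

theorem mainTheorem7 (ω : Ultrafilter ℕ) (hω : ∀ n : ℕ, ω ≠ pure n)
    (X : ℕ → MMSpace.{u}) (Y : MMSpace.{v}) :
    (Tendsto (fun n => MMSpace.boxDist (X n) Y) atTop (𝓝 0) →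
        MMSpace.SupportIsometricTo ω X Y) ∧
      (MMSpace.SupportIsometricTo ω X Y →
        ∀ ε : ℝ≥0∞, 0 < ε → {n : ℕ | MMSpace.boxDist (X n) Y < ε} ∈ ω) := by
  refine ⟨MMSpace.supportIsometricTo_of_tendsto ?_, fun h ε hε => ?_⟩
  -- A nonprincipal ultrafilter contains all cofinite sets, so ordinary limits are `ω`-limits.
  · rw [← Nat.cofinite_eq_atTop]
    exact ω.le_cofinite_or_eq_pure.resolve_right fun ⟨n, hn⟩ => hω n hn
  · obtain ⟨δ, hδ, hδε⟩ := ENNReal.lt_iff_exists_nnreal_btwn.1 hε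
    have hδ' : 0 < δ / 5 := div_pos (ENNReal.coe_pos.1 hδ) (by norm_num)
    refine (MMSpace.eventually_boxDist_le_of_supportIsometricTo h hδ').mono fun n hn => ?_
    rw [mul_div_cancel₀ _ (by norm_num)] at hn
    exact hn.trans_lt hδε
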